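/- Let $G$ be a connected finite simple graph with $p$ vertices, $q$ edges, vertex set $V(G)$ and edge set $E(G)$, and let $\mathbb{K}$ be a field. Let $\mathbb{K}[E(G)]$ and $\mathbb{K}[V(G)]$ be the polynomial rings over $\mathbb{K}$ whose indeterminates are the edges, respectively the vertices, of $G$, and let $I_G \subset \mathbb{K}[E(G)]$ be the toric ideal of $G$, that is, the kernel of the $\mathbb{K}$-algebra homomorphism $\varphi_G : \mathbb{K}[E(G)] \to \mathbb{K}[V(G)]$ with $\varphi_G(e) = vw$ for every edge $e = \{v, w\}$. Then \[ \operatorname{height}(I_G) = \begin{cases} q - p & \text{if } G \text{ is not bipartite},\\ q - p + 1 & \text{if } G \text{ is bipartite}, \end{cases} \] where $G$ is called bipartite if its chromatic number is at most $2$. -/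

import Mathlib

namespace SimpleGraph

/-- The monomial `v * w` in `K[V(G)]` attached to an unordered pair `{v, w}` of vertices. -/
noncomputable def edgeMonomial (K : Type*) [Field K] {V : Type*} (e : Sym2 V) :
    MvPolynomial V K :=
  Sym2.lift ⟨fun v w => MvPolynomial.X v * MvPolynomial.X w, fun _ _ => mul_comm _ _⟩ e

/-- The `K`-algebra homomorphism `φ_G : K[E(G)] → K[V(G)]` that sends the indeterminate of an
edge `{v, w}` to `v * w`. -/
noncomputable def toricMap (K : Type*) [Field K] {V : Type*} (G : SimpleGraph V) :
    MvPolynomial G.edgeSet K →ₐ[K] MvPolynomial V K :=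
  MvPolynomial.aeval fun e : G.edgeSet => edgeMonomial K (e : Sym2 V)

/-- The toric ideal `I_G` of the graph `G`: the kernel of `φ_G`. -/
noncomputable def toricIdeal (K : Type*) [Field K] {V : Type*} (G : SimpleGraph V) :
    Ideal (MvPolynomial G.edgeSet K) :=
  RingHom.ker (toricMap K G)

end SimpleGraph

open Polynomial in
/-- A prime of `R[X]` that meets a Noetherian domain `R` only in `0` has height at most `1`. -/
theorem Polynomial.height_le_one_of_comap_C_eq_bot {R : Type*} [CommRing R] [IsDomain R]
    [IsNoetherianRing R] (P : Ideal R[X]) [P.IsPrime] (h : P.comap C = ⊥) : P.height ≤ 1 := by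
  let M : Submonoid R[X] := (nonZeroDivisors R).map C
  let := Polynomial.algebra R (FractionRing R)
  have : IsLocalization M (FractionRing R)[X] :=
    Polynomial.isLocalization (nonZeroDivisors R) (FractionRing R)
  have disj : Disjoint (M : Set R[X]) P := by
    refine Set.disjoint_left.mpr ?_
    rintro _ ⟨b, hb, rfl⟩ ha
    have : b ∈ P.comap C := ha
    rw [h] at this
    exact nonZeroDivisors.ne_zero hb this
  rw [← IsLocalization.height_map_of_disjoint (S := (FractionRing R)[X]) M P disj]
  have hp := IsLocalization.isPrime_of_isPrime_disjoint M (FractionRing R)[X] P ‹_› disj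
  have := Ideal.height_le_ringKrullDim_of_ne_top hp.ne_top
  rw [Polynomial.ringKrullDim_of_isNoetherianRing, ringKrullDim_eq_zero_of_field] at this
  simpa using this

open Polynomial in
theorem Polynomial.height_eq_of_eq_map_C {R : Type*} [CommRing R] [IsNoetherianRing R]
    (p : Ideal R) [p.IsPrime] (P : Ideal R[X]) [P.IsPrime] [P.LiesOver p] (h : P = p.map C) :
    P.height = p.height := by
  rw [Ideal.height_eq_height_add_of_liesOver_of_hasGoingDown p P]
  have hbot : P.map (Ideal.Quotient.mk (p.map (algebraMap R R[X]))) = ⊥ := by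
    rw [h]; exact Ideal.map_quotient_self _
  have : (p.map (algebraMap R R[X])).IsPrime := by
    change (p.map C).IsPrime
    infer_instance
  rw [hbot, Ideal.height_bot, add_zero]

open Polynomial in
theorem Polynomial.height_eq_add_one_of_ne_map_C {R : Type*} [CommRing R] [IsNoetherianRing R]
    (p : Ideal R) [p.IsPrime] (P : Ideal R[X]) [P.IsPrime] [P.LiesOver p] (h : P ≠ p.map C) :
    P.height = p.height + 1 := by
  rw [Ideal.height_eq_height_add_of_liesOver_of_hasGoingDown p P]
  congr 1
  set I := p.map (algebraMap R R[X]) with hI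
  have hIP : I ≤ P := by
    rw [hI, Ideal.LiesOver.over (P := P) (p := p)]; exact Ideal.map_comap_le
  have : I.IsPrime := by
    change (p.map C).IsPrime
    infer_instance
  have hQ : (P.map (Ideal.Quotient.mk I)).IsPrime :=
    Ideal.map_isPrime_of_surjective Ideal.Quotient.mk_surjective (by rwa [Ideal.mk_ker])
  let e : (R[X] ⧸ I) ≃+* (R ⧸ p)[X] := (Ideal.polynomialQuotientEquivQuotientPolynomial p).symm
  apply le_antisymm
  · rw [← e.height_map]
    have : ((P.map (Ideal.Quotient.mk I)).map e).IsPrime := Ideal.map_isPrime_of_equiv e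
    apply Polynomial.height_le_one_of_comap_C_eq_bot
    rw [eq_bot_iff]
    intro r hr
    obtain ⟨r, rfl⟩ := Ideal.Quotient.mk_surjective r
    have h1 : e (Ideal.Quotient.mk I (C r)) = C (Ideal.Quotient.mk p r) := by
      rw [← Polynomial.map_C]
      exact Ideal.polynomialQuotientEquivQuotientPolynomial_symm_mk p (C r)
    rw [Ideal.mem_comap, ← h1, Ideal.mem_map_of_equiv] at hr
    obtain ⟨y, hy, hye⟩ := hr
    rw [e.injective hye, Ideal.mem_map_iff_of_surjective _ Ideal.Quotient.mk_surjective] at hy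
    obtain ⟨z, hz, hzr⟩ := hy
    have : C r ∈ P := by
      have := hIP (Ideal.Quotient.eq.mp hzr)
      simpa using P.sub_mem hz this
    have : r ∈ p := by rw [Ideal.LiesOver.over (P := P) (p := p)]; exact this
    simpa [Ideal.Quotient.eq_zero_iff_mem] using this
  · rw [Order.one_le_iff_ne_zero]
    intro h0
    apply h
    have := Ideal.height_eq_zero_iff_eq_bot.mp h0
    rw [Ideal.map_eq_bot_iff_le_ker, Ideal.mk_ker] at this
    exact le_antisymm this hIP

open MvPolynomial Algebra in
/-- The kernel of `aeval f` on polynomials in `Option σ` is extended from the kernel on polynomials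
in `σ` exactly if the value at `none` is transcendental over the other values. -/
theorem MvPolynomial.ker_aeval_comp_optionEquivLeft_symm_eq_map_C_iff {K A σ : Type*} [Field K]
    [CommRing A] [Algebra K A] (f : Option σ → A) :
    RingHom.ker ((aeval f : MvPolynomial (Option σ) K →ₐ[K] A).comp
        (optionEquivLeft K σ).symm.toAlgHom) =
      (RingHom.ker (aeval (f ∘ some) : MvPolynomial σ K →ₐ[K] A)).map Polynomial.C ↔
    ¬ IsAlgebraic (adjoin K (Set.range (f ∘ some))) (f none) := by
  let g : MvPolynomial σ K →ₐ[K] adjoin K (Set.range (f ∘ some)) :=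
    (aeval (f ∘ some)).codRestrict _ fun p => by
      rw [adjoin_range_eq_range_aeval]; exact ⟨p, rfl⟩
  have hg : ∀ p, (g p : A) = aeval (f ∘ some) p := fun p => rfl
  have hgs : Function.Surjective g := by
    rintro ⟨y, hy⟩
    rw [adjoin_range_eq_range_aeval] at hy
    obtain ⟨p, hp⟩ := hy
    exact ⟨p, Subtype.ext hp⟩
  have hmem : ∀ Q : Polynomial (MvPolynomial σ K), Q ∈ RingHom.ker ((aeval f : MvPolynomial (Option σ) K →ₐ[K] A).comp
        (optionEquivLeft K σ).symm.toAlgHom) ↔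
      Polynomial.aeval (f none) (Q.map (g : MvPolynomial σ K →+* adjoin K (Set.range (f ∘ some)))) = 0 := by
    intro Q
    rw [RingHom.mem_ker, Polynomial.aeval_def, Polynomial.eval₂_map]
    apply Eq.congr_left
    have : ((aeval f : MvPolynomial (Option σ) K →ₐ[K] A).comp
        (optionEquivLeft K σ).symm.toAlgHom : Polynomial (MvPolynomial σ K) →+* A) =
        Polynomial.eval₂RingHom ((algebraMap (adjoin K (Set.range (f ∘ some))) A).comp
          (g : MvPolynomial σ K →+* adjoin K (Set.range (f ∘ some)))) (f none) := by
      ext x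
      · simp
      · simp [hg]
      · simp
    exact DFunLike.congr_fun this Q
  have hmap : ∀ Q : Polynomial (MvPolynomial σ K),
      Q ∈ (RingHom.ker (aeval (f ∘ some) : MvPolynomial σ K →ₐ[K] A)).map Polynomial.C ↔
      Q.map (g : MvPolynomial σ K →+* adjoin K (Set.range (f ∘ some))) = 0 := by
    intro Q
    rw [Ideal.mem_map_C_iff, Polynomial.ext_iff]
    refine forall_congr' fun n => ?_
    rw [RingHom.mem_ker, Polynomial.coeff_map, Polynomial.coeff_zero, ← hg]
    exact ZeroMemClass.coe_eq_zero
  constructor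
  · rintro h ⟨q, hq0, hq⟩
    obtain ⟨Q, rfl⟩ := Polynomial.map_surjective (g : MvPolynomial σ K →+* adjoin K (Set.range (f ∘ some))) hgs q
    rw [← hmem, h, hmap] at hq
    exact hq0 hq
  · intro h
    ext Q
    rw [hmem, hmap]
    refine ⟨fun hq => ?_, fun hq => by rw [hq, map_zero]⟩
    by_contra h0
    exact h ⟨_, h0, hq⟩

open MvPolynomial AlgebraicIndependent in
/-- Height of the kernel plus rank of the values is the number of variables. -/
theorem MvPolynomial.height_ker_aeval_add_eRk {K A : Type*} [Field K] [CommRing A] [IsDomain A]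
    [Algebra K A] (σ : Type*) [Finite σ] (f : σ → A) :
    (RingHom.ker (aeval f : MvPolynomial σ K →ₐ[K] A)).height +
      (matroid K A).eRk (Set.range f) = (Nat.card σ : ℕ∞) := by
  induction σ using Finite.induction_empty_option with
  | @of_equiv α β e ih =>
    rw [← Nat.card_congr e, ← ih (f ∘ e), e.surjective.range_comp]
    congr 1
    rw [← (renameEquiv K e).toRingEquiv.height_comap]
    congr 1
    ext p
    simp [RingHom.mem_ker, Ideal.mem_comap, aeval_rename]
  | h_empty =>
    have : (RingHom.ker (aeval f : MvPolynomial PEmpty K →ₐ[K] A)) = ⊥ := by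
      rw [← RingHom.injective_iff_ker_eq_bot]
      exact algebraicIndependent_empty_type_iff.mpr (algebraMap K A).injective
    rw [this]
    simp [Set.range_eq_empty]
  | @h_option σ _ ih =>
    set φ : Polynomial (MvPolynomial σ K) →ₐ[K] A :=
      (aeval f).comp (optionEquivLeft K σ).symm.toAlgHom with hφ
    have hP : (RingHom.ker (aeval f : MvPolynomial (Option σ) K →ₐ[K] A)).height =
        (RingHom.ker φ).height := by
      rw [← (optionEquivLeft K σ).symm.toRingEquiv.height_comap]
      rfl
    have hprime := RingHom.ker_isPrime (φ : Polynomial (MvPolynomial σ K) →+* A)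
    change (RingHom.ker φ).IsPrime at hprime
    have hlies : (RingHom.ker φ).LiesOver
        (RingHom.ker (aeval (f ∘ some) : MvPolynomial σ K →ₐ[K] A)) := by
      constructor
      have : (aeval (f ∘ some) : MvPolynomial σ K →ₐ[K] A) =
        φ.comp Polynomial.CAlgHom := by
        ext i
        simp [hφ]
      rw [this]
      rfl
    have hprime' : (RingHom.ker (aeval (f ∘ some) : MvPolynomial σ K →ₐ[K] A)).IsPrime :=
      RingHom.ker_isPrime (aeval (f ∘ some) : MvPolynomial σ K →ₐ[K] A).toRingHom
    have hrange : Set.range f = insert (f none) (Set.range (f ∘ some)) := by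
      ext y; simp [Option.exists, eq_comm]
    have hcl : f none ∈ (matroid K A).closure (Set.range (f ∘ some)) ↔
        IsAlgebraic (Algebra.adjoin K (Set.range (f ∘ some))) (f none) := by
      rw [matroid_closure_eq]; rfl
    have key := MvPolynomial.ker_aeval_comp_optionEquivLeft_symm_eq_map_C_iff (K := K) f
    rw [hP, hrange, Finite.card_option, Nat.cast_add, ← ih (f ∘ some), Nat.cast_one]
    by_cases h : IsAlgebraic (Algebra.adjoin K (Set.range (f ∘ some))) (f none)
    · rw [Polynomial.height_eq_add_one_of_ne_map_C _ _ fun h' => key.mp h' h,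
        ← Matroid.eRk_insert_closure_eq, Set.insert_eq_of_mem (hcl.mpr h), Matroid.eRk_closure_eq,
        add_right_comm]
    · rw [Polynomial.height_eq_of_eq_map_C _ _ (key.mpr h),
        Matroid.eRk_insert_eq_add_one ⟨Set.mem_univ _, fun h' => h (hcl.mp h')⟩, add_assoc]

open MvPolynomial AlgebraicIndependent in
/-- If the values of `f` generate a subalgebra over which a polynomial ring in `τ` is algebraic,
the relations between them form an ideal of height `#σ - #τ`. -/
theorem MvPolynomial.height_ker_aeval_add_card {K : Type*} [Field K] {σ τ : Type*} [Finite σ]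
    [Finite τ] (f : σ → MvPolynomial τ K)
    (hf : ∀ v, IsAlgebraic (Algebra.adjoin K (Set.range f)) (X v : MvPolynomial τ K)) :
    (RingHom.ker (aeval f : MvPolynomial σ K →ₐ[K] MvPolynomial τ K)).height + Nat.card τ =
      (Nat.card σ : ℕ∞) := by
  rw [← MvPolynomial.height_ker_aeval_add_eRk (K := K) σ f]
  congr 1
  have : Algebra.IsAlgebraic (Algebra.adjoin K (Set.range f)) (MvPolynomial τ K) := by
    constructor
    intro p
    have : (⊤ : Subalgebra K _) ≤
        (Subalgebra.algebraicClosure (Algebra.adjoin K (Set.range f))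
          (MvPolynomial τ K)).restrictScalars K := by
      rw [← MvPolynomial.adjoin_range_X, Algebra.adjoin_le_iff]
      rintro _ ⟨v, rfl⟩
      exact hf v
    exact this (Algebra.mem_top : p ∈ ⊤)
  rw [← matroid_spanning_iff] at this
  rw [this.eRk_eq, ← Matroid.toENat_cRank_eq, matroid_cRank_eq, MvPolynomial.trdeg_of_isDomain]
  have := Fintype.ofFinite τ
  simp

namespace SimpleGraph

section Algebraic

variable {V B A : Type*} [CommRing B] [IsDomain B] [CommRing A] [IsDomain A] [Algebra B A]

/-- If products along edges are algebraic, then algebraicity spreads along a connected graph. -/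
theorem Connected.isAlgebraic_of_isAlgebraic {G : SimpleGraph V} (hG : G.Connected) {x : V → A}
    (hx : ∀ v, x v ≠ 0) (hadj : ∀ u w, G.Adj u w → IsAlgebraic B (x u * x w)) {v₀ : V}
    (h₀ : IsAlgebraic B (x v₀)) (v : V) : IsAlgebraic B (x v) := by
  obtain ⟨p⟩ := hG.preconnected v₀ v
  induction p with
  | nil => exact h₀
  | cons h p ih =>
    exact ih (.of_mul (mem_nonZeroDivisors_of_ne_zero (hx _)) h₀ (hadj _ _ h))

/-- If products along edges are algebraic, then every vertex of a connected graph is, up to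
algebraic factors, either inverse or equal to a given vertex. -/
theorem Connected.isAlgebraic_mul_or_exists {G : SimpleGraph V} (hG : G.Connected) {x : V → A}
    (hx : ∀ v, x v ≠ 0) (hadj : ∀ u w, G.Adj u w → IsAlgebraic B (x u * x w)) (v₀ v : V) :
    IsAlgebraic B (x v * x v₀) ∨
      ∃ b c : A, b ≠ 0 ∧ IsAlgebraic B b ∧ IsAlgebraic B c ∧ b * x v = c * x v₀ := by
  obtain ⟨p⟩ := hG.preconnected v v₀
  induction p with
  | nil => exact .inr ⟨1, 1, one_ne_zero, isAlgebraic_one, isAlgebraic_one, rfl⟩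
  | @cons u w z h p ih =>
    rcases ih with ih | ⟨b, c, hb, hba, hca, e⟩
    · exact .inr ⟨x w * x z, x u * x w, mul_ne_zero (hx _) (hx _), ih, hadj _ _ h, by ring⟩
    · by_cases hc : c = 0
      · simp [hc, hb, hx] at e
      left
      refine .of_mul (y := c) (mem_nonZeroDivisors_of_ne_zero hc) hca ?_
      have : c * (x u * x z) = b * (x u * x w) := by linear_combination -x u * e
      rw [this]
      exact hba.mul (hadj _ _ h)

/-- If products along edges are algebraic and the connected graph is not bipartite, then the
factors themselves are algebraic. -/
theorem Connected.isAlgebraic_of_not_isBipartite {G : SimpleGraph V} (hG : G.Connected)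
    (hbip : ¬ G.IsBipartite) {x : V → A} (hx : ∀ v, x v ≠ 0)
    (hadj : ∀ u w, G.Adj u w → IsAlgebraic B (x u * x w)) (v : V) : IsAlgebraic B (x v) := by
  classical
  by_contra hv
  have hsq : ¬ IsAlgebraic B (x v ^ 2) := fun h => hv (.of_pow two_pos h)
  refine hbip (Coloring.colorable (α := Bool)
    (Coloring.mk (fun u => decide (IsAlgebraic B (x u * x v))) ?_))
  intro u w h heq
  rw [decide_eq_decide] at heq
  by_cases hu : IsAlgebraic B (x u * x v)
  · refine hsq (.of_mul (mem_nonZeroDivisors_of_ne_zero (mul_ne_zero (hx u) (hx w)))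
      (hadj _ _ h) ?_)
    have := hu.mul (heq.mp hu)
    rwa [show x u * x v * (x w * x v) = x u * x w * x v ^ 2 by ring] at this
  · obtain ⟨b, c, hb, hba, hca, e⟩ :=
      (hG.isAlgebraic_mul_or_exists hx hadj v u).resolve_left hu
    obtain ⟨b', c', hb', hba', hca', e'⟩ :=
      (hG.isAlgebraic_mul_or_exists hx hadj v w).resolve_left fun hw => hu (heq.mpr hw)
    have hc : c * c' ≠ 0 := by
      intro h0
      have : b * x u * (b' * x w) = 0 := by rw [e, e']; linear_combination x v ^ 2 * h0
      simp [hb, hb', hx] at this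
    refine hsq (.of_mul (mem_nonZeroDivisors_of_ne_zero hc) (hca.mul hca') ?_)
    have : c * c' * x v ^ 2 = b * b' * (x u * x w) := by
      linear_combination -(b' * x w) * e - (c * x v) * e'
    rw [this]
    exact (hba.mul hba').mul (hadj _ _ h)

end Algebraic

open MvPolynomial

@[simp]
theorem aeval_edgeMonomial_mk {K V A : Type*} [Field K] [CommRing A] [Algebra K A] (x : V → A)
    (u w : V) : aeval x (edgeMonomial K s(u, w)) = x u * x w := by
  simp [edgeMonomial]

theorem isAlgebraic_adjoin_range_aeval_edgeMonomial {K V A : Type*} [Field K] [CommRing A]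
    [IsDomain A] [Algebra K A] {G : SimpleGraph V} (x : V → A) {u w : V} (h : G.Adj u w) :
    IsAlgebraic (Algebra.adjoin K (Set.range fun e : G.edgeSet => aeval x (edgeMonomial K e.1)))
      (x u * x w) := by
  have hmem : x u * x w ∈ Algebra.adjoin K
      (Set.range fun e : G.edgeSet => aeval x (edgeMonomial K e.1)) :=
    Algebra.subset_adjoin ⟨⟨s(u, w), h⟩, aeval_edgeMonomial_mk x u w⟩
  exact isAlgebraic_algebraMap (⟨_, hmem⟩ : Algebra.adjoin K _)

theorem Connected.height_toricIdeal_of_not_isBipartite (K : Type*) [Field K] {V : Type*} [Finite V]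
    {G : SimpleGraph V} (hG : G.Connected) (hbip : ¬ G.IsBipartite) :
    (toricIdeal K G).height + Nat.card V = Nat.card G.edgeSet := by
  have h := MvPolynomial.height_ker_aeval_add_card
    (fun e : G.edgeSet => aeval (X : V → MvPolynomial V K) (edgeMonomial K e.1))
    (hG.isAlgebraic_of_not_isBipartite hbip (fun v => X_ne_zero v) fun u w huw =>
      isAlgebraic_adjoin_range_aeval_edgeMonomial X huw)
  simp only [aeval_X_left_apply] at h
  exact h

/-- The vertex variables, with the variable of `v₀` set to `1`. -/
noncomputable def dehomogenizedVar (K : Type*) [Field K] {V : Type*} [DecidableEq V] (v₀ v : V) :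
    MvPolynomial {v // v ≠ v₀} K :=
  if h : v ≠ v₀ then X ⟨v, h⟩ else 1

theorem dehomogenizedVar_self (K : Type*) [Field K] {V : Type*} [DecidableEq V] (v₀ : V) :
    dehomogenizedVar K v₀ v₀ = 1 :=
  dif_neg (not_not.mpr rfl)

theorem dehomogenizedVar_coe (K : Type*) [Field K] {V : Type*} [DecidableEq V] (v₀ : V)
    (v : {v // v ≠ v₀}) : dehomogenizedVar K v₀ v = X v :=
  dif_pos v.2

theorem toricIdeal_eq_ker_dehomogenized (K : Type*) [Field K] {V : Type*} [DecidableEq V]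
    {G : SimpleGraph V} (hbip : G.IsBipartite) (v₀ : V) :
    toricIdeal K G = RingHom.ker (aeval fun e : G.edgeSet =>
      aeval (dehomogenizedVar K v₀) (edgeMonomial K e.1) :
      MvPolynomial G.edgeSet K →ₐ[K] MvPolynomial {v // v ≠ v₀} K) := by
  obtain ⟨c⟩ := hbip
  let ι := algebraMap (MvPolynomial V K) (FractionRing (MvPolynomial V K))
  have hι : ∀ v, ι (X v) ≠ 0 := fun v => by
    simp [ι]
  let τ : MvPolynomial {v // v ≠ v₀} K →ₐ[K] FractionRing (MvPolynomial V K) :=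
    aeval fun v => if c v = c v₀ then ι (X v.1) / ι (X v₀) else ι (X v.1) * ι (X v₀)
  have hτ : ∀ v, τ (dehomogenizedVar K v₀ v) =
      if c v = c v₀ then ι (X v) / ι (X v₀) else ι (X v) * ι (X v₀) := by
    intro v
    by_cases h : v = v₀
    · subst h
      simp [dehomogenizedVar, hι]
    · simp [dehomogenizedVar, h, τ]
  have hadj : ∀ u w, G.Adj u w →
      τ (dehomogenizedVar K v₀ u) * τ (dehomogenizedVar K v₀ w) = ι (X u) * ι (X w) := by
    intro u w h
    have hne := c.valid h
    have := hι v₀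
    rw [hτ, hτ]
    split_ifs with h1 h2 h2
    · exact absurd (h1.trans h2.symm) hne
    · field_simp
    · field_simp
    · omega
  set ψ : MvPolynomial G.edgeSet K →ₐ[K] MvPolynomial {v // v ≠ v₀} K :=
    aeval fun e : G.edgeSet => aeval (dehomogenizedVar K v₀) (edgeMonomial K e.1) with hψ
  have h1 : ψ = (aeval (dehomogenizedVar K v₀)).comp (toricMap K G) := by
    ext1 e
    simp [hψ, toricMap]
  have h2 : τ.comp ψ = (IsScalarTower.toAlgHom K (MvPolynomial V K) _).comp (toricMap K G) := by
    ext1 ⟨e, he⟩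
    induction e with
    | _ u w =>
      simpa [hψ, toricMap, edgeMonomial] using hadj u w he
  ext p
  rw [toricIdeal, RingHom.mem_ker, RingHom.mem_ker]
  constructor
  · intro h
    rw [h1, AlgHom.comp_apply, h, map_zero]
  · intro h
    have := DFunLike.congr_fun h2 p
    rw [AlgHom.comp_apply, AlgHom.comp_apply, h, map_zero] at this
    exact (map_eq_zero_iff ι (IsFractionRing.injective _ _)).mp this.symm

theorem Connected.height_toricIdeal_of_isBipartite (K : Type*) [Field K] {V : Type*} [Finite V]
    {G : SimpleGraph V} (hG : G.Connected) (hbip : G.IsBipartite) :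
    (toricIdeal K G).height + Nat.card V = Nat.card G.edgeSet + 1 := by
  classical
  obtain ⟨v₀⟩ := hG.nonempty
  have hx : ∀ v, dehomogenizedVar K v₀ v ≠ 0 := fun v => by
    unfold dehomogenizedVar
    split_ifs
    · exact X_ne_zero _
    · exact one_ne_zero
  have h := MvPolynomial.height_ker_aeval_add_card
    (fun e : G.edgeSet => aeval (dehomogenizedVar K v₀) (edgeMonomial K e.1)) (fun v => by
      rw [← dehomogenizedVar_coe]
      refine hG.isAlgebraic_of_isAlgebraic hx (fun u w huw =>
        isAlgebraic_adjoin_range_aeval_edgeMonomial _ huw) (v₀ := v₀) ?_ v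
      rw [dehomogenizedVar_self]
      exact isAlgebraic_one)
  rw [← toricIdeal_eq_ker_dehomogenized K hbip v₀] at h
  have := Fintype.ofFinite V
  have hcard : Nat.card V = Nat.card {v // v ≠ v₀} + 1 := by
    rw [← Finite.card_option, Nat.card_congr (Equiv.optionSubtypeNe v₀)]
  rw [hcard, Nat.cast_add, ← add_assoc, h, Nat.cast_one]

end SimpleGraph

theorem mainTheorem1 {K : Type*} [Field K] {V : Type*} [Finite V] (G : SimpleGraph V)
    (hG : G.Connected) :
    ∃ h : ℕ, (SimpleGraph.toricIdeal K G).height = (h : ℕ∞) ∧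
      (¬ G.IsBipartite → (h : ℤ) = (Nat.card G.edgeSet : ℤ) - (Nat.card V : ℤ)) ∧
      (G.IsBipartite → (h : ℤ) = (Nat.card G.edgeSet : ℤ) - (Nat.card V : ℤ) + 1) := by
  have hprime : (SimpleGraph.toricIdeal K G).IsPrime :=
    RingHom.ker_isPrime (SimpleGraph.toricMap K G).toRingHom
  obtain ⟨h, hh⟩ := ENat.ne_top_iff_exists.mp (Ideal.height_ne_top hprime.ne_top)
  refine ⟨h, hh.symm, fun hb => ?_, fun hb => ?_⟩
  · have := hG.height_toricIdeal_of_not_isBipartite K hb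
    rw [← hh] at this
    norm_cast at this
    omega
  · have := hG.height_toricIdeal_of_isBipartite K hb
    rw [← hh] at this
    norm_cast at this
    omega
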